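/- Let $G=G_1\times\dots\times G_k\times A$ be a finitely generated group, where $k\ge 0$, $A$ is free abelian (so $A\cong\mathbb Z^N$ for some $N\ge 0$), and each $G_i$ has trivial centre and is directly indecomposable (i.e. nontrivial and not a direct product of two nontrivial subgroups). Let $\varphi\in\mathrm{Aut}(G)$ satisfy $\varphi(\langle G_i,A\rangle)=\langle G_i,A\rangle$ for every $1\le i\le k$. For a finitely generated group $Q$, let $|\cdot|$ denote the word length with respect to a finite generating set and let $\|q\|=\min_{x\in Q}|xqx^{-1}|$ be the conjugacy length. Let $Q_{\rm ab}$ be the abelianisation of $Q$ modulo its torsion subgroup, $q_{\rm ab}\in Q_{\rm ab}$ the image of $q\in Q$, and $\varphi_{\rm ab}\in\mathrm{Aut}(Q_{\rm ab})$ the automorphism induced by $\varphi\in\mathrm{Aut}(Q)$. For sequences $a_n,b_n$ of non-negative reals write $a_n\sim b_n$ if there is a constant $C>0$ such that $a_n\le C b_n$ and $b_n\le C a_n$ for all $n\geq 0$. Then there exist automorphisms $\varphi_i\in\mathrm{Aut}(G_i)$ such that, for all choices of finite generating sets of $G$, of the $G_i$ and of $G_{\rm ab}$, and for every $g=(g_1,\dots,g_k,a)\in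 G$, $$|\varphi^n(g)|\sim\sum_{i=1}^k|\varphi_i^n(g_i)|+|\varphi_{\rm ab}^n(g_{\rm ab})|,\qquad \|\varphi^n(g)\|\sim\sum_{i=1}^k\|\varphi_i^n(g_i)\|+|\varphi_{\rm ab}^n(g_{\rm ab})|.$$ Moreover, for every $g\in G$ there exist a real algebraic integer $\lambda\ge 1$ and an integer $p\ge 0$ such that, for every finite generating set of $G_{\rm ab}$, there is $C>0$ with $$C^{-1}\,n^p\lambda^n\le|\varphi_{\rm ab}^n(g_{\rm ab})|\le C\,n^p\lambda^n\qquad\text{for all } n\ge 1.$$ Here, if $g_{\rm ab}$ is the identity, the identically zero sequence $|\varphi_{\rm ab}^n(g_{\rm ab})|$ is by convention replaced in this last statement by the constant sequence $1$. -/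

import Mathlib

namespace AutGrowth

/-- Word length of `g` with respect to `S`: the least length of a word in `S ∪ S⁻¹`
representing `g` (meaningful when `S` generates the group). -/
noncomputable def wordLength {Q : Type*} [Group Q] (S : Set Q) (g : Q) : ℕ :=
  sInf {n : ℕ | ∃ l : List Q, (∀ x ∈ l, x ∈ S ∨ x⁻¹ ∈ S) ∧ l.prod = g ∧ l.length = n}

/-- Conjugacy length: the least word length of a conjugate of `g`. -/
noncomputable def conjLength {Q : Type*} [Group Q] (S : Set Q) (g : Q) : ℕ :=
  ⨅ h : Q, wordLength S (h * g * h⁻¹)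

/-- `S` is a finite generating set. -/
def IsFinGen {Q : Type*} [Group Q] (S : Set Q) : Prop :=
  S.Finite ∧ Subgroup.closure S = ⊤

/-- `a ≼ b`: there is `C > 0` with `a n ≤ C * b n` for all `n ≥ 0`. -/
def SeqLE (a b : ℕ → ℝ) : Prop := ∃ C : ℝ, 0 < C ∧ ∀ n, a n ≤ C * b n

/-- `a ∼ b`: both `a ≼ b` and `b ≼ a`. -/
def SeqEquiv (a b : ℕ → ℝ) : Prop := SeqLE a b ∧ SeqLE b a

/-- A group is directly indecomposable if it is nontrivial and is not the internal direct product
of two nontrivial (normal) subgroups. -/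
def DirectlyIndecomposable (Q : Type*) [Group Q] : Prop :=
  Nontrivial Q ∧
    ∀ H K : Subgroup Q, H.Normal → K.Normal → IsCompl H K → H = ⊥ ∨ K = ⊥

/-- The free part of the abelianisation: the abelianisation modulo its torsion subgroup. -/
abbrev FreeAb (Q : Type*) [Group Q] : Type _ :=
  Abelianization Q ⧸ CommGroup.torsion (Abelianization Q)

/-- The natural projection `q ↦ q_ab`. -/
def toFreeAb (Q : Type*) [Group Q] : Q →* FreeAb Q :=
  (QuotientGroup.mk' (CommGroup.torsion (Abelianization Q))).comp Abelianization.of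

theorem map_torsion {B : Type*} [CommGroup B] (e : B ≃* B) :
    (CommGroup.torsion B).map (e : B →* B) = CommGroup.torsion B := by
  ext x
  rw [Subgroup.mem_map]
  constructor
  · rintro ⟨y, hy, rfl⟩
    exact MonoidHom.isOfFinOrder (e : B →* B) hy
  · intro hx
    exact ⟨e.symm x, MonoidHom.isOfFinOrder (e.symm : B →* B) hx, e.apply_symm_apply x⟩

/-- The automorphism `φ_ab` of `Q_ab` induced by an automorphism `φ` of `Q`. -/
def freeAbAut {Q : Type*} [Group Q] (φ : MulAut Q) : MulAut (FreeAb Q) :=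
  QuotientGroup.congr _ _ (MulEquiv.abelianizationCongr φ) (map_torsion _)

/-- `φ_ab` is characterised by `φ_ab (q_ab) = (φ q)_ab`. -/
theorem freeAbAut_toFreeAb {Q : Type*} [Group Q] (φ : MulAut Q) (q : Q) :
    freeAbAut φ (toFreeAb Q q) = toFreeAb Q (φ q) := rfl

/-- The sequence `n ↦ |f ^ n (x)|`, with the convention that the identity (whose length is `0`)
is given the constant sequence `1`. -/
noncomputable def growthSeq {Q : Type*} [Group Q] (S : Set Q) (f : MulAut Q) (x : Q) (n : ℕ) : ℝ :=
  open Classical in if x = 1 then 1 else (wordLength S ((f ^ n) x) : ℝ)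

/-- The subgroup `⟨G_i, A⟩` of `G_1 × ⋯ × G_k × A`. -/
def factorWithA {k : ℕ} (H : Fin k → Type*) [∀ i, Group (H i)] (A : Type*) [CommGroup A]
    (i : Fin k) : Subgroup ((∀ i, H i) × A) :=
  ((MonoidHom.inl (∀ i, H i) A).comp (MonoidHom.mulSingle H i)).range ⊔
    (MonoidHom.inr (∀ i, H i) A).range

end AutGrowth

/-! Elements of A are central and each G_i is centreless, so φ carries A to elements with trivial
G_i-components. As φ also preserves every ⟨G_i, A⟩, modulo A it acts diagonally, by automorphisms
φ_i (`exists_factorAut`). Only the A-component of φ^n(g) can mix the factors.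

Both equivalences then follow from bounds on a single element h = (h_i, a) of G, uniform in h and
hence applicable to every φ^n(g). Homomorphisms do not increase length beyond a constant factor, so
|h_i| and |h_ab| are bounded by multiples of |h|. Conversely |h| is at most a multiple of ∑|h_i| +
|a|, and |a| is at most a multiple of |h_ab|: the projection to the torsion-free group A factors
through G_ab. For conjugacy lengths, all the h_i are minimised by one conjugator, which leaves h_ab
unchanged.

For the growth of φ_ab, word length on the lattice G_ab is comparable to a norm on ℂ^r. The vector
of g_ab is split into generalised eigenvectors of the complexified map; each grows like n^p |μ|^n
(binomial formula), and the lexicographically largest (|μ|, p) dominates. Then λ = |μ| is an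
algebraic integer, and λ ≥ 1 because nontrivial elements have length at least 1. -/

namespace AutGrowth

/-! ### Growth of vectors under powers of a complex linear map -/

section LinearGrowth

open Filter Asymptotics Topology Module

theorem pow_mul_pow_isLittleO_of_lt {p q : ℕ} {r s : ℝ} (hr : 0 ≤ r) (hrs : r < s) :
    (fun n : ℕ => (n : ℝ) ^ p * r ^ n) =o[atTop] fun n : ℕ => (n : ℝ) ^ q * s ^ n := by
  have h1 := isLittleO_pow_const_mul_const_pow_const_pow_of_norm_lt (R := ℝ) p (r₁ := r) (r₂ := s)
    (by rwa [Real.norm_of_nonneg hr])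
  refine h1.trans_isBigO (IsBigO.of_bound 1 ?_)
  filter_upwards [eventually_ge_atTop 1] with n hn
  have hn' : (1 : ℝ) ≤ n := by exact_mod_cast hn
  rw [one_mul, norm_mul]
  refine le_mul_of_one_le_left (norm_nonneg _) ?_
  rw [Real.norm_of_nonneg (by positivity)]
  exact one_le_pow₀ hn'

theorem natCast_pow_isLittleO_of_lt {p q : ℕ} (h : p < q) :
    (fun n : ℕ => (n : ℝ) ^ p) =o[atTop] fun n : ℕ => (n : ℝ) ^ q :=
  (isLittleO_pow_pow_atTop_of_lt h).comp_tendsto tendsto_natCast_atTop_atTop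

/-- The lexicographic order is total, so a dominant rate among finitely many can be picked as a
maximum. -/
theorem pow_mul_pow_isBigO_of_lex_le {p q : ℕ} {r s : ℝ} (hr : 0 ≤ r)
    (h : toLex (r, p) ≤ toLex (s, q)) :
    (fun n : ℕ => (n : ℝ) ^ p * r ^ n) =O[atTop] fun n : ℕ => (n : ℝ) ^ q * s ^ n := by
  rcases Prod.Lex.toLex_le_toLex.1 h with h | ⟨h1, h2⟩
  · exact (pow_mul_pow_isLittleO_of_lt hr h).isBigO
  · dsimp only at h1 h2
    subst h1
    rcases h2.lt_or_eq with h2 | rfl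
    · exact (natCast_pow_isLittleO_of_lt h2).isBigO.mul (isBigO_refl _ _)
    · exact isBigO_refl _ _

variable {V : Type*} [NormedAddCommGroup V] [NormedSpace ℂ V]

/-- The growth of a nonzero generalised eigenvector for a nonzero eigenvalue. -/
theorem isTheta_pow_apply_of_mem_maxGenEigenspace (f : End ℂ V) {μ : ℂ} (hμ : μ ≠ 0) {w : V}
    (hw : w ∈ f.maxGenEigenspace μ) (hw0 : w ≠ 0) :
    ∃ p : ℕ, (fun n : ℕ => (f ^ n) w) =Θ[atTop] fun n : ℕ => (n : ℝ) ^ p * ‖μ‖ ^ n := by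
  set N : End ℂ V := f - μ • 1 with hN
  have hex : ∃ k, (N ^ k) w = 0 := (f.mem_maxGenEigenspace μ w).1 hw
  classical
  -- Here p is the last exponent with N^p w ≠ 0; it becomes the degree of the polynomial factor.
  obtain ⟨p, hp⟩ : ∃ p, Nat.find hex = p + 1 := by
    refine Nat.exists_eq_succ_of_ne_zero fun h => hw0 ?_
    simpa [h] using Nat.find_spec hex
  have hp0 : (N ^ p) w ≠ 0 := Nat.find_min hex (by omega)
  have hbig : ∀ j, p < j → (N ^ j) w = 0 := fun j hj => by
    obtain ⟨i, rfl⟩ := Nat.exists_eq_add_of_le' (Nat.succ_le_of_lt hj)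
    have h1 : (N ^ (p + 1)) w = 0 := hp ▸ Nat.find_spec hex
    rw [pow_add, Module.End.mul_apply, Nat.succ_eq_add_one, h1, map_zero]
  -- Binomial expansion of (N + μ)^n, truncated because N^j w = 0 for j > p. The term j = p
  -- dominates.
  have hformula : ∀ n, p ≤ n → (f ^ n) w =
      μ ^ n • ∑ j ∈ Finset.range (p + 1), (n.choose j : ℝ) • ((μ ^ j)⁻¹ • (N ^ j) w) := by
    intro n hn
    have hf : f = N + μ • 1 := by rw [hN]; abel
    have hc : Commute N (μ • (1 : End ℂ V)) := (Commute.one_right N).smul_right μ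
    rw [hf, hc.add_pow, LinearMap.sum_apply, Finset.smul_sum]
    symm
    refine Finset.sum_subset_zero_on_sdiff (Finset.range_mono (by omega)) ?_ ?_
    · intro j hj
      have hj' : p < j := by
        simp only [Finset.mem_sdiff, Finset.mem_range] at hj; omega
      rw [smul_pow, one_pow]
      simp only [Algebra.mul_smul_comm, mul_one, Module.End.mul_apply, LinearMap.smul_apply,
        Module.End.natCast_apply, map_nsmul, hbig j hj', smul_zero]
    · intro j hj
      have hj' : j ≤ n := by simp only [Finset.mem_range] at hj; omega
      rw [smul_pow, one_pow]
      simp only [Algebra.mul_smul_comm, mul_one, Module.End.mul_apply, LinearMap.smul_apply,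
        Module.End.natCast_apply, map_nsmul]
      rw [smul_comm, smul_smul, ← pow_sub₀ μ hμ hj', Nat.cast_smul_eq_nsmul, smul_comm]
  refine ⟨p, ?_⟩
  have hterm : ∀ j (v : V), v ≠ 0 →
      (fun n : ℕ => (n.choose j : ℝ) • v) =Θ[atTop] fun n : ℕ => (n : ℝ) ^ j := fun j v hv => by
    refine IsTheta.trans ?_ (isTheta_choose j)
    refine IsTheta.of_norm_left ?_
    simp_rw [norm_smul, mul_comm _ ‖v‖]
    exact (isTheta_const_mul_left (norm_ne_zero_iff.2 hv)).2 (isTheta_refl _ _).norm_left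
  have hlead := hterm p ((μ ^ p)⁻¹ • (N ^ p) w) (smul_ne_zero (inv_ne_zero (pow_ne_zero _ hμ)) hp0)
  have hlow : (fun n : ℕ => ∑ j ∈ Finset.range p, (n.choose j : ℝ) • ((μ ^ j)⁻¹ • (N ^ j) w))
      =o[atTop] fun n : ℕ => (n : ℝ) ^ p := by
    refine IsLittleO.fun_sum fun j hj => ?_
    by_cases hv : (μ ^ j)⁻¹ • (N ^ j) w = 0
    · simp only [hv, smul_zero]; exact isLittleO_zero _ _
    · exact (hterm j _ hv).1.trans_isLittleO (natCast_pow_isLittleO_of_lt (Finset.mem_range.1 hj))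
  have hsum : (fun n : ℕ => ∑ j ∈ Finset.range (p + 1), (n.choose j : ℝ) • ((μ ^ j)⁻¹ • (N ^ j) w))
      =Θ[atTop] fun n : ℕ => (n : ℝ) ^ p := by
    simp_rw [Finset.sum_range_succ]
    exact hlow.add_isTheta hlead
  have hμn : (fun n : ℕ => μ ^ n) =Θ[atTop] fun n : ℕ => ‖μ‖ ^ n := by
    refine IsTheta.of_norm_left ?_
    simp_rw [norm_pow]
    exact isTheta_refl _ _
  have := hμn.smul hsum
  simp_rw [smul_eq_mul, mul_comm (‖μ‖ ^ _)] at this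
  refine EventuallyEq.trans_isTheta ?_ this
  filter_upwards [eventually_ge_atTop p] with n hn using hformula n hn

/-- The growth of a nonzero vector under an injective endomorphism. -/
theorem exists_isTheta_pow_apply [FiniteDimensional ℂ V] (f : End ℂ V)
    (hf : Function.Injective f) {v : V} (hv : v ≠ 0) :
    ∃ (μ : ℂ) (p : ℕ), f.HasEigenvalue μ ∧
      (fun n : ℕ => (f ^ n) v) =Θ[atTop] fun n : ℕ => (n : ℝ) ^ p * ‖μ‖ ^ n := by
  have hmem : v ∈ ⨆ μ : ℂ, f.maxGenEigenspace μ := by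
    rw [f.iSup_maxGenEigenspace_eq_top]; trivial
  obtain ⟨c, hc, hcv⟩ := (Submodule.mem_iSup_iff_exists_finsupp _ _).1 hmem
  have hev : ∀ μ ∈ c.support, f.HasEigenvalue μ := fun μ hμ => by
    have h1 : f.maxGenEigenspace μ ≠ ⊥ := fun h =>
      (Finsupp.mem_support_iff.1 hμ) (by simpa [h] using hc μ)
    rw [Module.End.maxGenEigenspace_eq] at h1
    exact Module.End.hasEigenvalue_of_hasGenEigenvalue (k := f.maxGenEigenspaceIndex μ) h1
  have hne : ∀ μ ∈ c.support, μ ≠ 0 := fun μ hμ h0 => by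
    obtain ⟨x, hx⟩ := (hev μ hμ).exists_hasEigenvector
    exact hx.2 (hf (by rw [hx.apply_eq_smul, h0, zero_smul, map_zero]))
  have hgrow : ∀ μ : ℂ, ∃ p : ℕ, μ ∈ c.support →
      (fun n : ℕ => (f ^ n) (c μ)) =Θ[atTop] fun n : ℕ => (n : ℝ) ^ p * ‖μ‖ ^ n := fun μ => by
    by_cases hμ : μ ∈ c.support
    · obtain ⟨p, hp⟩ := isTheta_pow_apply_of_mem_maxGenEigenspace f (hne μ hμ) (hc μ)
        (Finsupp.mem_support_iff.1 hμ)
      exact ⟨p, fun _ => hp⟩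
    · exact ⟨0, fun h => absurd h hμ⟩
  choose p hp using hgrow
  have hsupp : c.support.Nonempty := by
    rw [Finsupp.support_nonempty_iff]
    rintro rfl
    exact hv (by simpa using hcv.symm)
  obtain ⟨μ, hμ, hmax⟩ := c.support.exists_max_image (fun μ => toLex (‖μ‖, p μ)) hsupp
  have hpow : ∀ n, (f ^ n) v = ∑ ν ∈ c.support, (f ^ n) (c ν) := fun n => by
    rw [← hcv, Finsupp.sum, map_sum]
  refine ⟨μ, p μ, hev μ hμ, ?_, ?_⟩
  · simp_rw [hpow]
    exact IsBigO.fun_sum fun ν hν =>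
      (hp ν hν).1.trans (pow_mul_pow_isBigO_of_lex_le (norm_nonneg _) (hmax ν hν))
  -- Other components of equal modulus cannot cancel the μ-component: projecting along the remaining
  -- generalised eigenspaces recovers it, and this projection is bounded in finite dimension.
  · have hcompl : IsCompl (f.maxGenEigenspace μ) (⨆ ν ≠ μ, f.maxGenEigenspace ν) := by
      refine ⟨f.independent_maxGenEigenspace μ, codisjoint_iff.2 (top_le_iff.1 ?_)⟩
      rw [← f.iSup_maxGenEigenspace_eq_top]
      refine iSup_le fun ν => ?_
      by_cases h : ν = μ
      · subst h; exact le_sup_left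
      · exact le_sup_of_le_right (le_iSup₂_of_le ν h le_rfl)
    set P := (f.maxGenEigenspace μ).projection _ hcompl
    have hmaps : ∀ n ν, (f ^ n) (c ν) ∈ f.maxGenEigenspace ν := fun n ν =>
      Module.End.mapsTo_maxGenEigenspace_of_comm ((Commute.refl f).pow_right n) ν (hc ν)
    have hP : ∀ n, P ((f ^ n) v) = (f ^ n) (c μ) := fun n => by
      rw [hpow, map_sum, Finset.sum_eq_single_of_mem μ hμ]
      · exact Submodule.projection_apply_of_mem_left hcompl (hmaps n μ)
      · intro ν _ hν
        refine (Submodule.projection_apply_eq_zero_iff hcompl).2 ?_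
        exact (le_iSup₂_of_le (f := fun ν (_ : ν ≠ μ) => f.maxGenEigenspace ν) ν hν le_rfl)
          (hmaps n ν)
    refine (hp μ hμ).2.trans ?_
    simp_rw [← hP]
    exact (LinearMap.toContinuousLinearMap P).isBigO_comp _ _

end LinearGrowth

/-! ### Word length and conjugacy length under homomorphisms -/

section WordLength

variable {Q R : Type*} [Group Q] [Group R]

theorem IsFinGen.exists_list {S : Set Q} (hS : IsFinGen S) (q : Q) :
    ∃ l : List Q, (∀ x ∈ l, x ∈ S ∨ x⁻¹ ∈ S) ∧ l.prod = q ∧ l.length = wordLength S q := by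
  refine Nat.sInf_mem (s := {n : ℕ | ∃ l : List Q, (∀ x ∈ l, x ∈ S ∨ x⁻¹ ∈ S) ∧ l.prod = q ∧
    l.length = n}) ?_
  have hq : q ∈ (Subgroup.closure S).toSubmonoid := by rw [hS.2]; trivial
  rw [Subgroup.closure_toSubmonoid] at hq
  obtain ⟨l, hl, hlq⟩ := Submonoid.exists_list_of_mem_closure hq
  exact ⟨l.length, l, fun x hx => by simpa using hl x hx, hlq, rfl⟩

theorem wordLength_le_length {S : Set Q} {l : List Q} (hl : ∀ x ∈ l, x ∈ S ∨ x⁻¹ ∈ S) :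
    wordLength S l.prod ≤ l.length :=
  Nat.sInf_le ⟨l, hl, rfl, rfl⟩

theorem wordLength_one (S : Set Q) : wordLength S 1 = 0 :=
  Nat.le_zero.1 (wordLength_le_length (S := S) (l := []) (by simp))

theorem IsFinGen.wordLength_mul_le {S : Set Q} (hS : IsFinGen S) (x y : Q) :
    wordLength S (x * y) ≤ wordLength S x + wordLength S y := by
  obtain ⟨l, hl, rfl, hlx⟩ := hS.exists_list x
  obtain ⟨m, hm, rfl, hmy⟩ := hS.exists_list y
  rw [← hlx, ← hmy, ← List.prod_append, ← List.length_append]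
  exact wordLength_le_length fun z hz => (List.mem_append.1 hz).elim (hl z) (hm z)

theorem IsFinGen.one_le_wordLength {S : Set Q} (hS : IsFinGen S) {x : Q} (hx : x ≠ 1) :
    1 ≤ wordLength S x := by
  obtain ⟨l, -, rfl, hl⟩ := hS.exists_list x
  rw [← hl, Nat.one_le_iff_ne_zero]
  rintro h
  exact hx (by rw [List.length_eq_zero_iff.1 h, List.prod_nil])

/-- A subadditive function is bounded by a multiple of the word length. -/
theorem IsFinGen.exists_le_mul_wordLength {S : Set Q} (hS : IsFinGen S) {ν : Q → ℝ}
    (h1 : ν 1 ≤ 0) (hmul : ∀ x y, ν (x * y) ≤ ν x + ν y) :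
    ∃ C : ℝ, 0 < C ∧ ∀ q, ν q ≤ C * wordLength S q := by
  obtain ⟨B, hB⟩ : BddAbove (ν '' (S ∪ S⁻¹)) := ((hS.1.union hS.1.inv).image ν).bddAbove
  refine ⟨max B 1, lt_max_of_lt_right one_pos, fun q => ?_⟩
  obtain ⟨l, hl, rfl, hlq⟩ := hS.exists_list q
  rw [← hlq]
  clear hlq
  induction l with
  | nil => simpa using h1
  | cons x l ih =>
    have hx : ν x ≤ max B 1 :=
      (hB ⟨x, by simpa using hl x (by simp), rfl⟩).trans (le_max_left _ _)
    have := ih fun y hy => hl y (List.mem_cons_of_mem _ hy)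
    rw [List.prod_cons, List.length_cons]
    push_cast
    linarith [hmul x l.prod]

theorem IsFinGen.exists_wordLength_map_le {S : Set Q} (hS : IsFinGen S) {T : Set R}
    (hT : IsFinGen T) (f : Q →* R) :
    ∃ C : ℝ, 0 < C ∧ ∀ q, (wordLength T (f q) : ℝ) ≤ C * wordLength S q :=
  hS.exists_le_mul_wordLength (ν := fun q => (wordLength T (f q) : ℝ))
    (by simp [wordLength_one]) fun x y => by
      rw [map_mul]; exact_mod_cast hT.wordLength_mul_le (f x) (f y)

theorem conjLength_le (S : Set Q) (g h : Q) : conjLength S g ≤ wordLength S (h * g * h⁻¹) :=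
  ciInf_le (OrderBot.bddBelow _) h

theorem exists_wordLength_conj_eq (S : Set Q) (g : Q) :
    ∃ h, wordLength S (h * g * h⁻¹) = conjLength S g :=
  ciInf_mem fun h => wordLength S (h * g * h⁻¹)

theorem IsFinGen.exists_conjLength_map_le {S : Set Q} (hS : IsFinGen S) {T : Set R}
    (hT : IsFinGen T) (f : Q →* R) :
    ∃ C : ℝ, 0 < C ∧ ∀ q, (conjLength T (f q) : ℝ) ≤ C * conjLength S q := by
  obtain ⟨C, hC, h⟩ := hS.exists_wordLength_map_le hT f
  refine ⟨C, hC, fun q => ?_⟩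
  obtain ⟨x, hx⟩ := exists_wordLength_conj_eq S q
  rw [← hx]
  refine le_trans ?_ (h _)
  rw [map_mul, map_mul, map_inv]
  exact_mod_cast conjLength_le T (f q) (f x)

theorem conjLength_of_comm {B : Type*} [CommGroup B] (T : Set B) (x : B) :
    conjLength T x = wordLength T x := by
  simp [conjLength]

theorem exists_isFinGen (Q : Type*) [Group Q] [Group.FG Q] : ∃ S : Set Q, IsFinGen S := by
  obtain ⟨S, hS, hf⟩ := (Group.fg_iff (G := Q)).1 inferInstance
  exact ⟨S, hf, hS⟩

end WordLength

/-! ### Growth of automorphisms of finitely generated free abelian groups -/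

section LatticeGrowth

open Filter Asymptotics Module

/-- ‖μ‖² is the product of μ and its conjugate, both integral. -/
theorem isIntegral_norm_of_isIntegral {μ : ℂ} (h : IsIntegral ℤ μ) : IsIntegral ℤ ‖μ‖ := by
  have hconj : IsIntegral ℤ ((starRingEnd ℂ) μ) := map_isIntegral_int (starRingEnd ℂ) h
  have h2 : IsIntegral ℤ ((‖μ‖ : ℂ) ^ 2) := by
    rw [← Complex.mul_conj']
    exact h.mul hconj
  exact (isIntegral_algebraMap_iff (R := ℤ) (A := ℝ) (B := ℂ)
    (FaithfulSMul.algebraMap_injective ℝ ℂ)).1 (IsIntegral.of_pow two_pos h2)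

/-- A monic integer polynomial annihilating `f` also annihilates its eigenvalues. -/
theorem isIntegral_of_hasEigenvalue {V : Type*} [AddCommGroup V] [Module ℂ V] {f : End ℂ V}
    (hf : IsIntegral ℤ f) {μ : ℂ} (hμ : f.HasEigenvalue μ) : IsIntegral ℤ μ := by
  obtain ⟨p, hp, hpf⟩ := hf
  obtain ⟨v, hv⟩ := hμ.exists_hasEigenvector
  refine ⟨p, hp, ?_⟩
  have h := Module.End.aeval_apply_of_hasEigenvector (p := p.map (algebraMap ℤ ℂ)) hv
  rw [Polynomial.aeval_map_algebraMap, Polynomial.aeval_def, hpf, LinearMap.zero_apply,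
    Polynomial.eval_map] at h
  exact (smul_eq_zero.1 h.symm).resolve_right hv.2

variable {B : Type*} [CommGroup B] {T : Set B}

theorem IsFinGen.wordLength_pow_le (hT : IsFinGen T) (y : B) (n : ℕ) :
    wordLength T (y ^ n) ≤ n * wordLength T y := by
  induction n with
  | zero => simp [wordLength_one]
  | succ n ih =>
    rw [pow_succ, add_mul, one_mul]
    exact (hT.wordLength_mul_le _ _).trans (by omega)

theorem IsFinGen.wordLength_zpow_le (hT : IsFinGen T) (y : B) (z : ℤ) :
    (wordLength T (y ^ z) : ℝ) ≤ |(z : ℝ)| * (wordLength T y + wordLength T y⁻¹) := by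
  obtain ⟨n, rfl | rfl⟩ := z.eq_nat_or_neg
  · have h : (wordLength T (y ^ n) : ℝ) ≤ n * wordLength T y := by
      exact_mod_cast hT.wordLength_pow_le y n
    rw [zpow_natCast, Int.cast_natCast, Nat.abs_cast, mul_add]
    exact h.trans (le_add_of_nonneg_right (by positivity))
  · have h : (wordLength T (y⁻¹ ^ n) : ℝ) ≤ n * wordLength T y⁻¹ := by
      exact_mod_cast hT.wordLength_pow_le y⁻¹ n
    rw [zpow_neg, zpow_natCast, ← inv_pow, Int.cast_neg, abs_neg, Int.cast_natCast, Nat.abs_cast,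
      mul_add]
    exact h.trans (le_add_of_nonneg_left (by positivity))

theorem IsFinGen.wordLength_prod_le (hT : IsFinGen T) {ι : Type*} (s : Finset ι) (y : ι → B) :
    wordLength T (∏ i ∈ s, y i) ≤ ∑ i ∈ s, wordLength T (y i) := by
  classical
  induction s using Finset.induction_on with
  | empty => simp [wordLength_one]
  | insert i s hi ih =>
    rw [Finset.prod_insert hi, Finset.sum_insert hi]
    exact (hT.wordLength_mul_le _ _).trans (by omega)

variable {ι : Type*}

/-- The complex coordinate vector of an element of a lattice. -/
noncomputable def latticeCoord (b : Basis ι ℤ (Additive B)) (x : B) : ι → ℂ :=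
  fun i => (b.repr (Additive.ofMul x) i : ℂ)

theorem latticeCoord_mul (b : Basis ι ℤ (Additive B)) (x y : B) :
    latticeCoord b (x * y) = latticeCoord b x + latticeCoord b y := by
  ext i
  simp [latticeCoord, ofMul_mul]

theorem latticeCoord_ne_zero (b : Basis ι ℤ (Additive B)) {x : B} (hx : x ≠ 1) :
    latticeCoord b x ≠ 0 := by
  intro h
  refine hx (Additive.ofMul.injective (b.repr.injective ?_))
  rw [ofMul_one, map_zero]
  ext i
  exact Int.cast_eq_zero.1 (congrFun h i)

variable [Fintype ι]

theorem IsFinGen.exists_norm_latticeCoord_le (hT : IsFinGen T) (b : Basis ι ℤ (Additive B)) :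
    ∃ C : ℝ, 0 < C ∧ ∀ x, ‖latticeCoord b x‖ ≤ C * wordLength T x := by
  refine hT.exists_le_mul_wordLength (ν := fun x => ‖latticeCoord b x‖) ?_ fun x y => ?_
  · have : latticeCoord b 1 = 0 := by
      ext i; simp [latticeCoord]
    simp [this]
  · rw [latticeCoord_mul]; exact norm_add_le _ _

theorem IsFinGen.exists_wordLength_le_norm_latticeCoord (hT : IsFinGen T)
    (b : Basis ι ℤ (Additive B)) :
    ∃ C : ℝ, 0 < C ∧ ∀ x, (wordLength T x : ℝ) ≤ C * ‖latticeCoord b x‖ := by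
  set c : ι → ℝ := fun i => wordLength T (b i).toMul + wordLength T ((b i).toMul)⁻¹
  have hc : ∀ i, 0 ≤ c i := fun i => by positivity
  -- The summand 1 keeps the constant positive even in rank 0.
  refine ⟨1 + ∑ i, c i, by linarith [Finset.sum_nonneg fun i (_ : i ∈ Finset.univ) => hc i],
    fun x => ?_⟩
  have hx : x = ∏ i, (b i).toMul ^ b.repr (Additive.ofMul x) i := by
    refine Additive.ofMul.injective ?_
    rw [ofMul_prod]
    exact (b.sum_repr (Additive.ofMul x)).symm
  calc (wordLength T x : ℝ)
      = wordLength T (∏ i, (b i).toMul ^ b.repr (Additive.ofMul x) i) := by rw [← hx]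
    _ ≤ ∑ i, (wordLength T ((b i).toMul ^ b.repr (Additive.ofMul x) i) : ℝ) := by
        exact_mod_cast hT.wordLength_prod_le _ _
    _ ≤ ∑ i, ‖latticeCoord b x‖ * c i := by
        refine Finset.sum_le_sum fun i _ => (hT.wordLength_zpow_le _ _).trans ?_
        refine mul_le_mul_of_nonneg_right ?_ (hc i)
        have := norm_le_pi_norm (latticeCoord b x) i
        simpa [latticeCoord] using this
    _ ≤ (1 + ∑ i, c i) * ‖latticeCoord b x‖ := by
        rw [← Finset.mul_sum, add_mul, mul_comm ‖_‖]
        exact le_add_of_nonneg_left (by positivity)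

/-- Complexification of the endomorphisms of a lattice, in coordinates. -/
noncomputable def complexify [DecidableEq ι] (b : Basis ι ℤ (Additive B)) :
    End ℤ (Additive B) →+* End ℂ (ι → ℂ) :=
  (Matrix.toLinAlgEquiv' (R := ℂ) (n := ι)).toRingEquiv.toRingHom.comp
    ((Int.castRingHom ℂ).mapMatrix.comp (LinearMap.toMatrixAlgEquiv b).toRingEquiv.toRingHom)

theorem complexify_apply_latticeCoord [DecidableEq ι] (b : Basis ι ℤ (Additive B))
    (f : End ℤ (Additive B)) (x : B) :
    complexify b f (latticeCoord b x) = latticeCoord b (f (Additive.ofMul x)).toMul := by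
  ext i
  have h := congrFun (LinearMap.toMatrix_mulVec_repr b b f (Additive.ofMul x)) i
  have h2 := RingHom.map_mulVec (Int.castRingHom ℂ) (LinearMap.toMatrix b b f)
    (b.repr (Additive.ofMul x)) i
  rw [h] at h2
  exact h2.symm

theorem exists_growth_of_ne_one [Group.FG B] [IsMulTorsionFree B] (f : MulAut B) {x : B}
    (hx : x ≠ 1) :
    ∃ (lam : ℝ) (p : ℕ), IsIntegral ℤ lam ∧ 1 ≤ lam ∧ ∀ T : Set B, IsFinGen T →
      ∃ C : ℝ, 0 < C ∧ ∀ n : ℕ, 1 ≤ n →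
        (wordLength T ((f ^ n) x) : ℝ) ≤ C * ((n : ℝ) ^ p * lam ^ n) ∧
        (n : ℝ) ^ p * lam ^ n ≤ C * wordLength T ((f ^ n) x) := by
  classical
  have : Module.Finite ℤ (Additive B) := Module.Finite.iff_addGroup_fg.2 inferInstance
  set b := Module.finBasis ℤ (Additive B)
  set F : MulAut B → End ℤ (Additive B) := fun f => (MonoidHom.toAdditive (f : B →* B)).toIntLinearMap
  have hunit : IsUnit (F f) :=
    ⟨⟨F f, F f⁻¹, LinearMap.ext fun y => f.apply_symm_apply y.toMul,
      LinearMap.ext fun y => f.symm_apply_apply y.toMul⟩, rfl⟩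
  have hinj : Function.Injective (complexify b (F f)) :=
    ((Module.End.isUnit_iff _).1 (hunit.map (complexify b))).1
  have hcoord : ∀ n : ℕ, ((complexify b (F f)) ^ n) (latticeCoord b x)
      = latticeCoord b ((f ^ n) x) := fun n => by
    induction n with
    | zero => rfl
    | succ n ih =>
      rw [pow_succ', Module.End.mul_apply, ih, complexify_apply_latticeCoord, pow_succ']
      rfl
  obtain ⟨μ, p, hμ, hΘ⟩ := exists_isTheta_pow_apply _ hinj (latticeCoord_ne_zero b hx)
  simp_rw [hcoord] at hΘ
  have hint : IsIntegral ℤ ‖μ‖ := isIntegral_norm_of_isIntegral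
    (isIntegral_of_hasEigenvalue (map_isIntegral_int (complexify b)
      (Algebra.IsIntegral.isIntegral (F f))) hμ)
  have hxn : ∀ n : ℕ, (f ^ n) x ≠ 1 := fun n h => hx ((MulEquiv.map_eq_one_iff _).1 h)
  obtain ⟨C₁, hC₁, h₁⟩ := bound_of_isBigO_nat_atTop hΘ.1
  obtain ⟨C₂, hC₂, h₂⟩ := bound_of_isBigO_nat_atTop hΘ.2
  have hμ0 : 0 < ‖μ‖ := by
    obtain ⟨v, hv⟩ := hμ.exists_hasEigenvector
    refine norm_pos_iff.2 fun h0 => hv.2 (hinj ?_)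
    rw [hv.apply_eq_smul, h0, zero_smul, map_zero]
  -- The restriction to n ≥ 1 matters: at n = 0 the comparison sequence vanishes when p > 0.
  have hg : ∀ n : ℕ, 1 ≤ n → 0 < (n : ℝ) ^ p * ‖μ‖ ^ n := fun n hn => by
    have : (0 : ℝ) < n := by exact_mod_cast hn
    positivity
  have hupper : ∀ n : ℕ, 1 ≤ n → ‖latticeCoord b ((f ^ n) x)‖ ≤ C₁ * ((n : ℝ) ^ p * ‖μ‖ ^ n) :=
    fun n hn => by simpa [Real.norm_of_nonneg (hg n hn).le] using h₁ (hg n hn).ne'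
  have hlower : ∀ n : ℕ, 1 ≤ n → (n : ℝ) ^ p * ‖μ‖ ^ n ≤ C₂ * ‖latticeCoord b ((f ^ n) x)‖ :=
    fun n hn => by
      simpa [Real.norm_of_nonneg (hg n hn).le] using h₂ (latticeCoord_ne_zero b (hxn n))
  refine ⟨‖μ‖, p, hint, ?_, fun T hT => ?_⟩
  -- If ‖μ‖ < 1, the lengths would tend to 0, yet nontrivial elements have length at least 1.
  · by_contra! hlt
    obtain ⟨S, hS⟩ := exists_isFinGen B
    obtain ⟨D, hD, hSD⟩ := hS.exists_wordLength_le_norm_latticeCoord b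
    have hlim : Tendsto (fun n : ℕ => D * (C₁ * ((n : ℝ) ^ p * ‖μ‖ ^ n))) atTop (nhds 0) := by
      simpa using ((tendsto_pow_const_mul_const_pow_of_abs_lt_one p
        (by rwa [abs_norm])).const_mul C₁).const_mul D
    obtain ⟨n, hn1, hn⟩ := ((hlim.eventually (gt_mem_nhds one_pos)).and
      (eventually_ge_atTop 1)).exists
    have h3 : (1 : ℝ) ≤ wordLength S ((f ^ n) x) := by
      exact_mod_cast hS.one_le_wordLength (hxn n)
    have h4 := (hSD _).trans (mul_le_mul_of_nonneg_left (hupper n hn) hD.le)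
    linarith
  · obtain ⟨D, hD, hTD⟩ := hT.exists_wordLength_le_norm_latticeCoord b
    obtain ⟨E, hE, hTE⟩ := hT.exists_norm_latticeCoord_le b
    refine ⟨D * C₁ + C₂ * E, by positivity, fun n hn => ⟨?_, ?_⟩⟩
    · have h3 := (hTD _).trans (mul_le_mul_of_nonneg_left (hupper n hn) hD.le)
      have := mul_nonneg (mul_nonneg hC₂.le hE.le) (hg n hn).le
      linarith
    · have h3 := (hlower n hn).trans (mul_le_mul_of_nonneg_left (hTE _) hC₂.le)
      have : 0 ≤ D * C₁ * wordLength T ((f ^ n) x) := by positivity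
      linarith

end LatticeGrowth

/-! ### The free part of the abelianisation -/

section FreeAb

variable {Q : Type*} [Group Q]

theorem toFreeAb_surjective (Q : Type*) [Group Q] : Function.Surjective (toFreeAb Q) :=
  (QuotientGroup.mk'_surjective _).comp (QuotientGroup.mk'_surjective _)

theorem freeAbAut_pow_toFreeAb (φ : MulAut Q) (n : ℕ) (q : Q) :
    (freeAbAut φ ^ n) (toFreeAb Q q) = toFreeAb Q ((φ ^ n) q) := by
  induction n with
  | zero => rfl
  | succ n ih => rw [pow_succ', MulAut.mul_apply, ih, freeAbAut_toFreeAb, pow_succ', MulAut.mul_apply]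

/-- A homomorphism to a torsion-free commutative group factors through the free part of the
abelianisation. -/
theorem exists_comp_toFreeAb_eq {A : Type*} [CommGroup A] [IsMulTorsionFree A] (f : Q →* A) :
    ∃ F : FreeAb Q →* A, F.comp (toFreeAb Q) = f := by
  refine ⟨QuotientGroup.lift _ (Abelianization.lift f) fun x hx => ?_, ?_⟩
  · by_contra h
    exact not_isOfFinOrder_of_isMulTorsionFree h
      (MonoidHom.isOfFinOrder (Abelianization.lift f) hx)
  · ext q
    rfl

theorem isMulTorsionFree_of_free {A : Type*} [CommGroup A] (hA : Module.Free ℤ (Additive A)) :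
    IsMulTorsionFree A := by
  have : IsAddTorsionFree (Additive A) :=
    Module.isTorsionFree_int_iff_isAddTorsionFree.1 inferInstance
  exact ⟨fun n hn x y h => nsmul_right_injective (M := Additive A) hn h⟩

end FreeAb

/-! ### Automorphisms and lengths in the direct product -/

section Product

variable {k : ℕ} {H : Fin k → Type*} [∀ i, Group (H i)] {A : Type*} [CommGroup A]

/-- Surjectivity of φ makes the image of a central element central, so its components lie in the
trivial centres. -/
theorem apply_inr_fst_of_center_eq_bot (hcentre : ∀ i, Subgroup.center (H i) = ⊥)
    (φ : MulAut ((∀ i, H i) × A)) (a : A) : (φ (1, a)).1 = 1 := by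
  funext i
  have hmem : (φ (1, a)).1 i ∈ Subgroup.center (H i) := by
    rw [Subgroup.mem_center_iff]
    intro x
    obtain ⟨y, hy⟩ := φ.surjective (Pi.mulSingle i x, 1)
    have h : φ y * φ (1, a) = φ (1, a) * φ y := by
      rw [← map_mul, ← map_mul]
      congr 1
      ext <;> simp [mul_comm]
    have := congrFun (congrArg Prod.fst h) i
    simpa [hy] using this
  rw [hcentre i] at hmem
  exact hmem

theorem mem_factorWithA {i : Fin k} {g : (∀ i, H i) × A} (hg : g ∈ factorWithA H A i)
    {j : Fin k} (hj : j ≠ i) : g.1 j = 1 := by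
  have hle : factorWithA H A i ≤
      ((Pi.evalMonoidHom H j).comp (MonoidHom.fst (∀ i, H i) A)).ker := by
    refine sup_le ?_ ?_
    · rintro _ ⟨x, rfl⟩
      simp [MonoidHom.mem_ker, hj]
    · rintro _ ⟨x, rfl⟩
      simp [MonoidHom.mem_ker]
  exact hle hg

theorem mulSingle_mem_factorWithA (i : Fin k) (x : H i) :
    ((Pi.mulSingle i x, 1) : (∀ i, H i) × A) ∈ factorWithA H A i :=
  (le_sup_left : _ ≤ factorWithA H A i) ⟨x, rfl⟩

/-- The endomorphism of the factor `H i` induced by an automorphism of the product. -/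
def factorEnd (φ : MulAut ((∀ i, H i) × A)) (i : Fin k) : H i →* H i :=
  (((Pi.evalMonoidHom H i).comp (MonoidHom.fst (∀ i, H i) A)).comp (φ : _ →* _)).comp
    ((MonoidHom.inl (∀ i, H i) A).comp (MonoidHom.mulSingle H i))

/-- φ is diagonal modulo A: for j ≠ i, the image of the j-th factor lies in ⟨G_j, A⟩ and has trivial
i-th component, as does the image of A. -/
theorem apply_fst_eq_factorEnd (hcentre : ∀ i, Subgroup.center (H i) = ⊥)
    (φ : MulAut ((∀ i, H i) × A))
    (hφ : ∀ i, (factorWithA H A i).map φ.toMonoidHom = factorWithA H A i)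
    (g : (∀ i, H i) × A) (i : Fin k) : (φ g).1 i = factorEnd φ i (g.1 i) := by
  have hpi : (((Pi.evalMonoidHom H i).comp (MonoidHom.fst (∀ i, H i) A)).comp (φ : _ →* _)).comp
      (MonoidHom.inl (∀ i, H i) A) = (factorEnd φ i).comp (Pi.evalMonoidHom H i) := by
    refine MonoidHom.pi_ext fun j x => ?_
    by_cases hj : j = i
    · subst hj
      simp [factorEnd]
    · have h1 : φ (Pi.mulSingle j x, 1) ∈ factorWithA H A j := by
        rw [← hφ j]
        exact ⟨_, mulSingle_mem_factorWithA j x, rfl⟩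
      have h2 := mem_factorWithA h1 (Ne.symm hj)
      simpa [Pi.mulSingle_eq_of_ne (Ne.symm hj)] using h2
  have hg : g = (g.1, 1) * (1, g.2) := by ext <;> simp
  have h1 : (φ (g.1, 1)).1 i = factorEnd φ i (g.1 i) := DFunLike.congr_fun hpi g.1
  have h2 := congrFun (apply_inr_fst_of_center_eq_bot hcentre φ g.2) i
  conv_lhs => rw [hg]
  rw [map_mul, Prod.fst_mul, Pi.mul_apply, h1, h2, Pi.one_apply, mul_one]

theorem exists_factorAut (hcentre : ∀ i, Subgroup.center (H i) = ⊥)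
    (φ : MulAut ((∀ i, H i) × A))
    (hφ : ∀ i, (factorWithA H A i).map φ.toMonoidHom = factorWithA H A i) :
    ∃ φ' : ∀ i, MulAut (H i), ∀ (n : ℕ) g i, ((φ ^ n) g).1 i = (φ' i ^ n) (g.1 i) := by
  have hψ : ∀ i, (factorWithA H A i).map (φ⁻¹ : MulAut _).toMonoidHom = factorWithA H A i := by
    intro i
    conv_lhs => rw [← hφ i]
    rw [Subgroup.map_map]
    convert Subgroup.map_id _
    ext1 x
    exact φ.symm_apply_apply x
  -- Applied to φ and φ⁻¹ in both orders, this makes the induced endomorphisms mutually inverse.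
  have key : ∀ (α β : MulAut ((∀ i, H i) × A)),
      (∀ i, (factorWithA H A i).map α.toMonoidHom = factorWithA H A i) →
      (∀ x, α (β x) = x) → ∀ i, Function.LeftInverse (factorEnd α i) (factorEnd β i) := by
    intro α β hα h i x
    change factorEnd α i ((β (Pi.mulSingle i x, 1)).1 i) = x
    rw [← apply_fst_eq_factorEnd hcentre α hα, h]
    simp
  refine ⟨fun i => MulEquiv.mk' ⟨factorEnd φ i, factorEnd φ⁻¹ i,
    key φ⁻¹ φ hψ φ.symm_apply_apply i, key φ φ⁻¹ hφ φ.apply_symm_apply i⟩ (map_mul (factorEnd φ i)),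
    fun n g i => ?_⟩
  induction n with
  | zero => rfl
  | succ n ih =>
    rw [pow_succ', MulAut.mul_apply, pow_succ', MulAut.mul_apply, ← ih]
    exact apply_fst_eq_factorEnd hcentre φ hφ _ i

/-- Word length in the product is bounded by the sum of the word lengths of the factors. -/
theorem IsFinGen.exists_wordLength_prod_le {S : Set ((∀ i, H i) × A)} (hS : IsFinGen S)
    {S' : ∀ i, Set (H i)} (hS' : ∀ i, IsFinGen (S' i)) {U : Set A} (hU : IsFinGen U) :
    ∃ C : ℝ, 0 < C ∧ ∀ g, (wordLength S g : ℝ) ≤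
      C * ((∑ i, (wordLength (S' i) (g.1 i) : ℝ)) + wordLength U g.2) := by
  choose c hc hcle using fun i => (hS' i).exists_wordLength_map_le hS
    ((MonoidHom.inl (∀ i, H i) A).comp (MonoidHom.mulSingle H i))
  obtain ⟨d, hd, hdle⟩ := hU.exists_wordLength_map_le hS (MonoidHom.inr (∀ i, H i) A)
  -- Induction on a finite set containing the support, splitting off one coordinate at a time.
  have hsum : ∀ (s : Finset (Fin k)) (h : ∀ i, H i), (∀ i, i ∉ s → h i = 1) →
      (wordLength S (h, 1) : ℝ) ≤ ∑ i ∈ s, c i * wordLength (S' i) (h i) := by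
    intro s
    induction s using Finset.induction_on with
    | empty =>
      intro h hh
      have : h = 1 := funext fun i => hh i (by simp)
      subst this
      rw [← Prod.one_eq_mk, wordLength_one]
      simp
    | insert i s hi ih =>
      intro h hh
      have hdec : ((h, 1) : (∀ i, H i) × A)
          = (Pi.mulSingle i (h i), 1) * (Function.update h i 1, 1) := by
        refine Prod.ext (funext fun j => ?_) (by simp)
        by_cases hj : j = i
        · subst hj; simp
        · simp [hj]
      have h1 := ih (Function.update h i 1) fun j hj => by
        by_cases hji : j = i
        · subst hji; simp
        · rw [Function.update_of_ne hji]; exact hh j (by simp [hji, hj])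
      have h2 : ∑ j ∈ s, c j * (wordLength (S' j) (Function.update h i 1 j) : ℝ)
          = ∑ j ∈ s, c j * (wordLength (S' j) (h j) : ℝ) :=
        Finset.sum_congr rfl fun j hj => by
          rw [Function.update_of_ne (ne_of_mem_of_not_mem hj hi)]
      have h3 : (wordLength S (h, 1) : ℝ) ≤ wordLength S (Pi.mulSingle i (h i), (1 : A))
          + wordLength S (Function.update h i 1, (1 : A)) := by
        rw [hdec]; exact_mod_cast hS.wordLength_mul_le _ _
      have h4 : (wordLength S (Pi.mulSingle i (h i), (1 : A)) : ℝ)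
        ≤ c i * wordLength (S' i) (h i) := hcle i (h i)
      rw [Finset.sum_insert hi]
      linarith
  have hc0 : 0 ≤ ∑ i, c i := Finset.sum_nonneg fun i _ => (hc i).le
  refine ⟨(∑ i, c i) + d, by linarith, fun g => ?_⟩
  have hg : g = (g.1, 1) * (1, g.2) := by ext <;> simp
  have h1 : (wordLength S g : ℝ) ≤ wordLength S (g.1, (1 : A))
      + wordLength S ((1 : ∀ i, H i), g.2) := by
    conv_lhs => rw [hg]
    exact_mod_cast hS.wordLength_mul_le _ _
  have h2 : (wordLength S ((1 : ∀ i, H i), g.2) : ℝ) ≤ d * wordLength U g.2 := hdle g.2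
  have h3 : ∑ i, c i * (wordLength (S' i) (g.1 i) : ℝ)
      ≤ (∑ i, c i) * ∑ i, (wordLength (S' i) (g.1 i) : ℝ) := by
    rw [Finset.mul_sum]
    refine Finset.sum_le_sum fun i _ => mul_le_mul_of_nonneg_right ?_ (by positivity)
    exact Finset.single_le_sum (fun j _ => (hc j).le) (Finset.mem_univ i)
  have h4 := hsum Finset.univ g.1 fun i hi => absurd (Finset.mem_univ i) hi
  have h5 : 0 ≤ (∑ i, c i) * (wordLength U g.2 : ℝ) := by positivity
  have h6 : 0 ≤ d * ∑ i, (wordLength (S' i) (g.1 i) : ℝ) := by positivity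
  linarith

theorem exists_sum_add_le {α : Type*} {f : Fin k → α → ℝ} {e r : α → ℝ}
    (hf : ∀ i, ∃ C : ℝ, 0 < C ∧ ∀ x, f i x ≤ C * r x) (he : ∃ C : ℝ, 0 < C ∧ ∀ x, e x ≤ C * r x) :
    ∃ C : ℝ, 0 < C ∧ ∀ x, (∑ i, f i x) + e x ≤ C * r x := by
  choose c hc hcle using hf
  obtain ⟨d, hd, hdle⟩ := he
  refine ⟨(∑ i, c i) + d, by linarith [Finset.sum_nonneg fun i (_ : i ∈ Finset.univ) => (hc i).le],
    fun x => ?_⟩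
  rw [add_mul, Finset.sum_mul]
  exact add_le_add (Finset.sum_le_sum fun i _ => hcle i x) (hdle x)

/-- This lets |g_ab| replace the length of the A-component, which φ does not transform on its own.
-/
theorem exists_wordLength_snd_le [IsMulTorsionFree A] {T : Set (FreeAb ((∀ i, H i) × A))}
    (hT : IsFinGen T) {U : Set A} (hU : IsFinGen U) :
    ∃ C : ℝ, 0 < C ∧ ∀ g : (∀ i, H i) × A,
      (wordLength U g.2 : ℝ) ≤ C * wordLength T (toFreeAb _ g) := by
  obtain ⟨F, hF⟩ := exists_comp_toFreeAb_eq (MonoidHom.snd (∀ i, H i) A)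
  obtain ⟨C, hC, h⟩ := hT.exists_wordLength_map_le hU F
  exact ⟨C, hC, fun g => by
    have := h (toFreeAb _ g)
    rwa [← MonoidHom.comp_apply, hF] at this⟩

variable {S : Set ((∀ i, H i) × A)} {S' : ∀ i, Set (H i)}
  {T : Set (FreeAb ((∀ i, H i) × A))}

theorem exists_sum_add_le_wordLength (hS : IsFinGen S) (hS' : ∀ i, IsFinGen (S' i))
    (hT : IsFinGen T) :
    ∃ C : ℝ, 0 < C ∧ ∀ g, (∑ i, (wordLength (S' i) (g.1 i) : ℝ)) + wordLength T (toFreeAb _ g)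
      ≤ C * wordLength S g :=
  exists_sum_add_le (fun i => hS.exists_wordLength_map_le (hS' i)
    ((Pi.evalMonoidHom H i).comp (MonoidHom.fst (∀ i, H i) A)))
    (hS.exists_wordLength_map_le hT (toFreeAb _))

theorem exists_sum_add_le_conjLength (hS : IsFinGen S) (hS' : ∀ i, IsFinGen (S' i))
    (hT : IsFinGen T) :
    ∃ C : ℝ, 0 < C ∧ ∀ g, (∑ i, (conjLength (S' i) (g.1 i) : ℝ)) + wordLength T (toFreeAb _ g)
      ≤ C * conjLength S g := by
  refine exists_sum_add_le (fun i => hS.exists_conjLength_map_le (hS' i)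
    ((Pi.evalMonoidHom H i).comp (MonoidHom.fst (∀ i, H i) A))) ?_
  simpa only [conjLength_of_comm] using hS.exists_conjLength_map_le hT (toFreeAb _)

variable [IsMulTorsionFree A] [Group.FG A]

theorem exists_wordLength_le_sum_add (hS : IsFinGen S) (hS' : ∀ i, IsFinGen (S' i))
    (hT : IsFinGen T) :
    ∃ C : ℝ, 0 < C ∧ ∀ g, (wordLength S g : ℝ) ≤
      C * ((∑ i, (wordLength (S' i) (g.1 i) : ℝ)) + wordLength T (toFreeAb _ g)) := by
  obtain ⟨U, hU⟩ := exists_isFinGen A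
  obtain ⟨C, hC, h⟩ := hS.exists_wordLength_prod_le hS' hU
  obtain ⟨D, hD, h'⟩ := exists_wordLength_snd_le hT hU
  refine ⟨C * (1 + D), by positivity, fun g => (h g).trans ?_⟩
  rw [mul_assoc]
  refine mul_le_mul_of_nonneg_left ?_ hC.le
  have h1 : 0 ≤ D * ∑ i, (wordLength (S' i) (g.1 i) : ℝ) := by positivity
  have h2 : (0 : ℝ) ≤ wordLength T (toFreeAb _ g) := by positivity
  linarith [h' g]

theorem exists_conjLength_le_sum_add (hS : IsFinGen S) (hS' : ∀ i, IsFinGen (S' i))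
    (hT : IsFinGen T) :
    ∃ C : ℝ, 0 < C ∧ ∀ g, (conjLength S g : ℝ) ≤
      C * ((∑ i, (conjLength (S' i) (g.1 i) : ℝ)) + wordLength T (toFreeAb _ g)) := by
  obtain ⟨C, hC, h⟩ := exists_wordLength_le_sum_add hS hS' hT
  refine ⟨C, hC, fun g => ?_⟩
  choose x hx using fun i => exists_wordLength_conj_eq (S' i) (g.1 i)
  -- Conjugation acts coordinatewise, so `(x, 1)` attains all the factor minima at once.
  have h1 := h ((x, 1) * g * (x, 1)⁻¹)
  have h2 : toFreeAb _ ((x, 1) * g * (x, 1)⁻¹) = toFreeAb _ g := by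
    rw [map_mul, map_mul, map_inv, mul_inv_cancel_comm]
  have h3 : ∀ i, wordLength (S' i) (((x, 1) * g * (x, 1)⁻¹).1 i) = conjLength (S' i) (g.1 i) := hx
  rw [h2] at h1
  simp_rw [h3] at h1
  refine le_trans ?_ h1
  exact_mod_cast conjLength_le S g (x, 1)

end Product

end AutGrowth

/-! ### Assembly of the main theorem -/

theorem mainTheorem4 {k : ℕ} (H : Fin k → Type*) [∀ i, Group (H i)] (A : Type*) [CommGroup A]
    (hfg : Group.FG ((∀ i, H i) × A))
    (hA : Module.Free ℤ (Additive A))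
    (hcentre : ∀ i, Subgroup.center (H i) = ⊥)
    (hindec : ∀ i, AutGrowth.DirectlyIndecomposable (H i))
    (φ : MulAut ((∀ i, H i) × A))
    (hφ : ∀ i, (AutGrowth.factorWithA H A i).map φ.toMonoidHom = AutGrowth.factorWithA H A i) :
    (∃ φ' : ∀ i, MulAut (H i),
      ∀ (S : Set ((∀ i, H i) × A)) (S' : ∀ i, Set (H i))
        (T : Set (AutGrowth.FreeAb ((∀ i, H i) × A))),
        AutGrowth.IsFinGen S → (∀ i, AutGrowth.IsFinGen (S' i)) → AutGrowth.IsFinGen T →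
        ∀ g : (∀ i, H i) × A,
          AutGrowth.SeqEquiv
            (fun n => (AutGrowth.wordLength S ((φ ^ n) g) : ℝ))
            (fun n => (∑ i, (AutGrowth.wordLength (S' i) ((φ' i ^ n) (g.1 i)) : ℝ)) +
              (AutGrowth.wordLength T
                ((AutGrowth.freeAbAut φ ^ n) (AutGrowth.toFreeAb _ g)) : ℝ)) ∧
          AutGrowth.SeqEquiv
            (fun n => (AutGrowth.conjLength S ((φ ^ n) g) : ℝ))
            (fun n => (∑ i, (AutGrowth.conjLength (S' i) ((φ' i ^ n) (g.1 i)) : ℝ)) +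
              (AutGrowth.wordLength T
                ((AutGrowth.freeAbAut φ ^ n) (AutGrowth.toFreeAb _ g)) : ℝ))) ∧
    (∀ g : (∀ i, H i) × A, ∃ (lam : ℝ) (p : ℕ), IsIntegral ℤ lam ∧ 1 ≤ lam ∧
      ∀ T : Set (AutGrowth.FreeAb ((∀ i, H i) × A)), AutGrowth.IsFinGen T →
        ∃ C : ℝ, 0 < C ∧ ∀ n : ℕ, 1 ≤ n →
          AutGrowth.growthSeq T (AutGrowth.freeAbAut φ) (AutGrowth.toFreeAb _ g) n
            ≤ C * ((n : ℝ) ^ p * lam ^ n) ∧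
          (n : ℝ) ^ p * lam ^ n
            ≤ C * AutGrowth.growthSeq T (AutGrowth.freeAbAut φ) (AutGrowth.toFreeAb _ g) n) := by
  have := AutGrowth.isMulTorsionFree_of_free hA
  have hAfg : Group.FG A := Group.fg_of_surjective (f := MonoidHom.snd (∀ i, H i) A)
    Prod.snd_surjective
  refine ⟨?_, fun g => ?_⟩
  · obtain ⟨φ', hφ'⟩ := AutGrowth.exists_factorAut hcentre φ hφ
    refine ⟨φ', fun S S' T hS hS' hT g => ?_⟩
    -- Every term now depends only on φ^n(g), so the uniform bounds apply with constants independent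
    -- of n.
    simp_rw [AutGrowth.freeAbAut_pow_toFreeAb, ← hφ']
    obtain ⟨C₁, hC₁, h₁⟩ := AutGrowth.exists_wordLength_le_sum_add hS hS' hT
    obtain ⟨C₂, hC₂, h₂⟩ := AutGrowth.exists_sum_add_le_wordLength hS hS' hT
    obtain ⟨C₃, hC₃, h₃⟩ := AutGrowth.exists_conjLength_le_sum_add hS hS' hT
    obtain ⟨C₄, hC₄, h₄⟩ := AutGrowth.exists_sum_add_le_conjLength hS hS' hT
    exact ⟨⟨⟨C₁, hC₁, fun n => h₁ _⟩, ⟨C₂, hC₂, fun n => h₂ _⟩⟩,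
      ⟨⟨C₃, hC₃, fun n => h₃ _⟩, ⟨C₄, hC₄, fun n => h₄ _⟩⟩⟩
  · by_cases hg : AutGrowth.toFreeAb _ g = 1
    · refine ⟨1, 0, isIntegral_one, le_rfl, fun T _ => ⟨1, one_pos, fun n _ => ?_⟩⟩
      simp [AutGrowth.growthSeq, hg]
    · have hfg' : Group.FG (AutGrowth.FreeAb ((∀ i, H i) × A)) :=
        Group.fg_of_surjective (AutGrowth.toFreeAb_surjective _)
      simp only [AutGrowth.growthSeq, if_neg hg]
      exact AutGrowth.exists_growth_of_ne_one _ hg
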